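/- Let $P_0$ be a probability law on $\mathbb{R}$ (the law of the score under no shift) with finite mean $\mu_S$, let $\lambda\in\mathbb{R}$ be such that $\psi(\lambda)=\log \mathbb{E}_{P_0}[e^{\lambda(S-\mu_S)}]$ is finite, and let $S_1,S_2,\dots$ be real random variables (the scores) on a probability space whose probability and expectation are written $P_1$ and $\mathbb{E}_{P_1}$. Put $$Y_t=\lambda(S_t-\mu_S)-\psi(\lambda),\qquad M_t=\prod_{i=1}^t e^{Y_i},\qquad T(\tau)=\inf\{t\ge 1: M_t\ge\tau\}\in\mathbb{N}\cup\{\infty\}.$$ Let $\nu\ge 0$ be a fixed integer (the change point; $\nu=0$ means that all scores are post-change). Suppose that the post-change process $(S_{\nu+j})_{j\ge1}$ is strictly stationary and $\alpha$-mixing, with mixing coefficients $$\alpha(n)=\sup_{k\ge1}\ \sup\{|P_1(A\cap B)-P_1(A)P_1(B)|: A\in\sigma(S_{\nu+j},\,1\le j\le k),\ B\in\sigma(S_{\nu+j},\,j\ge k+n)\}$$ satisfying $\sum_{n\ge1}\alpha(n)^{1/r}<\infty$ for some $r>1$, and that $\sup_{t\ge1}\mathbb{E}_{P_1}[e^{\eta|Y_t|}]<\infty$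 for some $\eta>0$. If the limit $\Gamma=\lim_{t\to\infty}\frac1t\,\mathbb{E}_{P_1}\big[\sum_{i=1}^tY_i\big]$ exists and is positive, then $$\mathbb{E}_{P_1}[T(\tau)]\lesssim\frac{\log\tau}{\Gamma}\qquad(\tau\to\infty),$$ in the sharp leading-order sense: for every $\varepsilon>0$ there is $\tau_0$ such that $\mathbb{E}_{P_1}[T(\tau)]\le(1+\varepsilon)\,\frac{\log\tau}{\Gamma}$ for all $\tau\ge\tau_0$. -/

import Mathlib

open MeasureTheory ProbabilityTheory Filter Topology
open scoped ENNReal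

namespace ShiftDetection

noncomputable section

/-- Strict stationarity of a real-valued process `X 0, X 1, X 2, …` under `P`: the whole path law
is invariant under time shifts. -/
def IsStationary {Ω : Type*} [MeasurableSpace Ω] (P : Measure Ω) (X : ℕ → Ω → ℝ) : Prop :=
  ∀ k : ℕ, IdentDistrib (fun ω (j : ℕ) => X (j + k) ω) (fun ω (j : ℕ) => X j ω) P P

/-- The σ-algebra generated by the variables `X j` with `j ≤ k`. -/
@[reducible] def past {Ω : Type*} (X : ℕ → Ω → ℝ) (k : ℕ) : MeasurableSpace Ω :=
  ⨆ j : {j : ℕ // j ≤ k}, MeasurableSpace.comap (X j.1) inferInstance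

/-- The σ-algebra generated by the variables `X j` with `j ≥ k`. -/
@[reducible] def future {Ω : Type*} (X : ℕ → Ω → ℝ) (k : ℕ) : MeasurableSpace Ω :=
  ⨆ j : {j : ℕ // k ≤ j}, MeasurableSpace.comap (X j.1) inferInstance

/-- The strong mixing coefficients
`α(n) = sup {|P(A ∩ B) - P(A) P(B)| : k ∈ ℕ, A ∈ σ(X j, j ≤ k), B ∈ σ(X j, j ≥ k + n)}`.
The set of reals is nonempty and bounded by `1` when `P` is a probability measure. -/
def mixingCoeff {Ω : Type*} [MeasurableSpace Ω] (P : Measure Ω) (X : ℕ → Ω → ℝ) (n : ℕ) : ℝ :=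
  sSup {x : ℝ | ∃ (k : ℕ) (A B : Set Ω), MeasurableSet[past X k] A ∧
    MeasurableSet[future X (k + n)] B ∧ x = |P.real (A ∩ B) - P.real A * P.real B|}

/-- `α`-mixing (strong mixing): `α(n) → 0`. -/
def IsAlphaMixing {Ω : Type*} [MeasurableSpace Ω] (P : Measure Ω) (X : ℕ → Ω → ℝ) : Prop :=
  Tendsto (mixingCoeff P X) atTop (𝓝 0)

/-- The mean score `μ_S` under the null score law `P₀`. -/
def nullMean (P₀ : Measure ℝ) : ℝ := ∫ s, s ∂P₀

/-- The log-moment generating function `ψ(lam) = log E_{P₀}[exp (lam (S - μ_S))]`. -/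
def logMgf (P₀ : Measure ℝ) (lam : ℝ) : ℝ :=
  cgf (fun s => s - nullMean P₀) P₀ lam

/-- The increments `Y_t = lam (S_t - μ_S) - ψ(lam)`. -/
def increment {Ω : Type*} (P₀ : Measure ℝ) (lam : ℝ) (S : ℕ → Ω → ℝ) (t : ℕ) (ω : Ω) : ℝ :=
  lam * (S t ω - nullMean P₀) - logMgf P₀ lam

/-- The exponential process `M_t = ∏_{i=1}^t exp (Y_i)`, with `M_0 = 1`. -/
def expProcess {Ω : Type*} (P₀ : Measure ℝ) (lam : ℝ) (S : ℕ → Ω → ℝ) (t : ℕ) (ω : Ω) : ℝ :=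
  ∏ i ∈ Finset.Icc 1 t, Real.exp (increment P₀ lam S i ω)

/-- The detection time `T(τ) = inf {t ≥ 1 : M_t ≥ τ}`, equal to `∞` if there is no such `t`. -/
def detectionTime {Ω : Type*} (P₀ : Measure ℝ) (lam : ℝ) (S : ℕ → Ω → ℝ) (τ : ℝ) (ω : Ω) :
    ℝ≥0∞ :=
  ⨅ (t : ℕ) (_ : 1 ≤ t ∧ τ ≤ expProcess P₀ lam S t ω), (t : ℝ≥0∞)

end

end ShiftDetection

/-!
Write `V n` for the sum of the first `n` post-change increments and `F` for the sum of the
pre-change ones, so that `log (M (ν + n)) = F + V n`, and let `Γ` be the common mean of the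
post-change increments, which by stationarity is the limit of the averaged means. For `s < Γ` and
`n ≥ log τ / s`, the threshold can be missed at time `ν + n` only if `V n` lies below a line of
slope `c ∈ (s, Γ)` or `F` lies below `-(c - s) n`. Hence the detection time exceeds
`ν + ⌈log τ / s⌉` by at most the number of `n` for which one of these happens, and it is enough that this number
has finite mean, which does not depend on `τ` (`exists_lintegral_detectionTime_le`). For `F` this
is integrability; for `V` it is `∑ P(V n < c n) < ∞` (`summable_measureReal_sum_lt`).

The variance of `V n` is of order `n`, so Chebyshev's inequality for `V n` gives a bound of order
`1 / n`, which just fails to be summable. Applied to blocks it suffices. Truncate the increments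
at `b = n ^ κ` with a small `κ` and cut the `n` indices into about `b²` blocks of length `p`. One
or two blocks with a low sum change the total by `O(n / b)` only, so `V n < c n` forces two
*non-adjacent* blocks to be low (`le_sum_of_low_blocks_adjacent`). These are a distance `p` apart,
so by strong mixing the two events are independent up to `α(p)`, and the probability is at most
`b⁴` times `O(b⁴ / n)² + α(p)` up to a constant (`measureReal_sum_lt_le`). Summability of
`α(n) ^ (1 / r)` and monotonicity give `α(n) = O(n ^ (-r))` with `r > 1` (`exists_le_div_rpow`), so both
terms are summable once `κ` is small. The variance of a block is bounded through the covariance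
inequality for bounded functions, a double application of the layer cake formula
(`abs_integral_mul_sub_le`).
-/

namespace ShiftDetection

/-! ### Covariances under strong mixing -/

lemma antitone_measureReal_lt {Ω : Type*} [MeasurableSpace Ω] (μ : Measure Ω) [IsFiniteMeasure μ]
    (f : Ω → ℝ) : Antitone fun t : ℝ => μ.real {a | t < f a} := fun _ _ hst =>
  measureReal_mono fun _ ha => lt_of_le_of_lt hst ha

lemma integral_eq_integral_Ioc_measureReal_lt {Ω : Type*} [MeasurableSpace Ω] (μ : Measure Ω)
    [IsFiniteMeasure μ] {f : Ω → ℝ} (hf : Measurable f) (h0 : ∀ ω, 0 ≤ f ω) (h1 : ∀ ω, f ω ≤ 1) :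
    ∫ ω, f ω ∂μ = ∫ t in Set.Ioc (0 : ℝ) 1, μ.real {a | t < f a} := by
  have hint : Integrable f μ := Integrable.of_bound hf.aestronglyMeasurable 1
    (ae_of_all _ fun ω => by rw [Real.norm_eq_abs, abs_of_nonneg (h0 ω)]; exact h1 ω)
  rw [hint.integral_eq_integral_meas_lt (ae_of_all _ h0)]
  refine setIntegral_eq_of_subset_of_forall_sdiff_eq_zero measurableSet_Ioi
    Set.Ioc_subset_Ioi_self ?_
  intro t ht
  have ht1 : 1 < t := by
    by_contra h
    exact ht.2 ⟨ht.1, not_lt.1 h⟩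
  have : {a | t < f a} = ∅ := by
    ext a
    simpa using (h1 a).trans ht1.le
  simp [this]

/-- Two finite measures that are close on the superlevel sets of a `[0, 1]`-valued function
integrate it to nearby values. -/
lemma abs_integral_sub_integral_le_of_measureReal_lt {Ω : Type*} [MeasurableSpace Ω]
    (μ ν : Measure Ω) [IsFiniteMeasure μ] [IsFiniteMeasure ν] {f : Ω → ℝ} (hf : Measurable f)
    (h0 : ∀ ω, 0 ≤ f ω) (h1 : ∀ ω, f ω ≤ 1) {c : ℝ}
    (h : ∀ t : ℝ, |μ.real {a | t < f a} - ν.real {a | t < f a}| ≤ c) :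
    |∫ ω, f ω ∂μ - ∫ ω, f ω ∂ν| ≤ c := by
  have hI (ρ : Measure Ω) [IsFiniteMeasure ρ] :
      IntegrableOn (fun t : ℝ => ρ.real {a | t < f a}) (Set.Ioc 0 1) :=
    (((antitone_measureReal_lt ρ f).antitoneOn _).integrableOn_isCompact isCompact_Icc).mono_set
      Set.Ioc_subset_Icc_self
  rw [integral_eq_integral_Ioc_measureReal_lt μ hf h0 h1,
    integral_eq_integral_Ioc_measureReal_lt ν hf h0 h1, ← integral_sub (hI μ) (hI ν)]
  have := norm_setIntegral_le_of_norm_le_const (μ := volume) (s := Set.Ioc (0 : ℝ) 1)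
    (f := fun t : ℝ => μ.real {a | t < f a} - ν.real {a | t < f a}) (C := c) (by simp)
    (fun t _ => h t)
  simpa using this

/-- If the events of two σ-algebras are `c`-almost independent, so are `[0, 1]`-valued functions
measurable with respect to them. The layer cake bound is applied first to `P(A ∩ ·)` against
`P(A) P`, then to the measure `g P` against `E[g] P`. -/
lemma abs_integral_mul_sub_le {Ω : Type*} {m₁ m₂ m : MeasurableSpace Ω} (P : Measure Ω)
    [IsProbabilityMeasure P] (hm₁ : m₁ ≤ m) (hm₂ : m₂ ≤ m) {c : ℝ}
    (h : ∀ A B, MeasurableSet[m₁] A → MeasurableSet[m₂] B →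
      |P.real (A ∩ B) - P.real A * P.real B| ≤ c)
    {f g : Ω → ℝ} (hf : Measurable[m₁] f) (hg : Measurable[m₂] g)
    (hf0 : ∀ ω, 0 ≤ f ω) (hf1 : ∀ ω, f ω ≤ 1) (hg0 : ∀ ω, 0 ≤ g ω) (hg1 : ∀ ω, g ω ≤ 1) :
    |∫ ω, f ω * g ω ∂P - (∫ ω, f ω ∂P) * ∫ ω, g ω ∂P| ≤ c := by
  have hfm : Measurable f := hf.mono hm₁ le_rfl
  have hgm : Measurable g := hg.mono hm₂ le_rfl
  have hgi : Integrable g P := Integrable.of_bound hgm.aestronglyMeasurable 1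
    (ae_of_all _ fun ω => by rw [Real.norm_eq_abs, abs_of_nonneg (hg0 ω)]; exact hg1 ω)
  have hEg : 0 ≤ ∫ ω, g ω ∂P := integral_nonneg hg0
  have : IsFiniteMeasure (ENNReal.ofReal (∫ ω, g ω ∂P) • P) :=
    Measure.smul_finite P ENNReal.ofReal_ne_top
  have hA : ∀ A, MeasurableSet[m₁] A → |∫ ω in A, g ω ∂P - P.real A * ∫ ω, g ω ∂P| ≤ c := by
    intro A hA
    have : IsFiniteMeasure (P A • P) := Measure.smul_finite P (measure_ne_top P A)
    have key := abs_integral_sub_integral_le_of_measureReal_lt (P.restrict A) ((P A) • P) hgm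
      hg0 hg1 (c := c) ?_
    · rwa [integral_smul_measure] at key
    · intro t
      have hB : MeasurableSet[m₂] {a | t < g a} := hg measurableSet_Ioi
      rw [measureReal_restrict_apply (hm₂ _ hB), Set.inter_comm]
      simpa [measureReal_def] using h A _ hA hB
  have hdens (A : Set Ω) (hA : MeasurableSet A) :
      (P.withDensity fun ω => ENNReal.ofReal (g ω)).real A = ∫ ω in A, g ω ∂P := by
    rw [measureReal_def, withDensity_apply _ hA,
      integral_eq_lintegral_of_nonneg_ae (ae_of_all _ hg0) hgm.aestronglyMeasurable]
  have : IsFiniteMeasure (P.withDensity fun ω => ENNReal.ofReal (g ω)) :=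
    isFiniteMeasure_withDensity_ofReal hgi.2
  have key := abs_integral_sub_integral_le_of_measureReal_lt
    (P.withDensity fun ω => ENNReal.ofReal (g ω)) (ENNReal.ofReal (∫ ω, g ω ∂P) • P) hfm
      hf0 hf1 (c := c) ?_
  · rw [integral_smul_measure, integral_withDensity_eq_integral_toReal_smul
      hgm.ennreal_ofReal (by simp)] at key
    simpa [hEg, hg0, ENNReal.toReal_ofReal, mul_comm] using key
  · intro t
    have hB : MeasurableSet[m₁] {a | t < f a} := hf measurableSet_Ioi
    rw [hdens _ (hm₁ _ hB)]
    simpa [measureReal_def, hEg, mul_comm] using hA _ hB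

lemma future_antitone {Ω : Type*} {X : ℕ → Ω → ℝ} {k l : ℕ} (h : k ≤ l) : future X l ≤ future X k :=
  iSup_le fun j =>
    le_iSup (fun j : {j : ℕ // k ≤ j} => MeasurableSpace.comap (X j.1) inferInstance)
      ⟨j.1, h.trans j.2⟩

lemma measurable_past {Ω : Type*} {X : ℕ → Ω → ℝ} {j k : ℕ} (h : j ≤ k) :
    Measurable[past X k] (X j) :=
  Measurable.mono (comap_measurable (X j))
    (le_iSup (fun j : {j : ℕ // j ≤ k} => MeasurableSpace.comap (X j.1) inferInstance) ⟨j, h⟩)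
    le_rfl

lemma measurable_future {Ω : Type*} {X : ℕ → Ω → ℝ} {j k : ℕ} (h : k ≤ j) :
    Measurable[future X k] (X j) :=
  Measurable.mono (comap_measurable (X j))
    (le_iSup (fun j : {j : ℕ // k ≤ j} => MeasurableSpace.comap (X j.1) inferInstance) ⟨j, h⟩)
    le_rfl

section Mixing

variable {Ω : Type*} [mΩ : MeasurableSpace Ω] {P : Measure Ω} [IsProbabilityMeasure P]
  {X : ℕ → Ω → ℝ}

lemma past_le (hX : ∀ j, Measurable (X j)) (k : ℕ) : past X k ≤ mΩ :=
  iSup_le fun j => (hX j.1).comap_le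

lemma future_le (hX : ∀ j, Measurable (X j)) (k : ℕ) : future X k ≤ mΩ :=
  iSup_le fun j => (hX j.1).comap_le

lemma abs_measureReal_inter_sub_le_one (A B : Set Ω) :
    |P.real (A ∩ B) - P.real A * P.real B| ≤ 1 := by
  have h1 : P.real (A ∩ B) ≤ 1 := measureReal_le_one
  have h2 : P.real A * P.real B ≤ 1 :=
    mul_le_one₀ measureReal_le_one measureReal_nonneg measureReal_le_one
  have h3 : 0 ≤ P.real (A ∩ B) := measureReal_nonneg
  have h4 : 0 ≤ P.real A * P.real B := mul_nonneg measureReal_nonneg measureReal_nonneg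
  rw [abs_le]
  constructor <;> linarith

variable (P X) in
lemma bddAbove_mixing (n : ℕ) : BddAbove {x : ℝ | ∃ (k : ℕ) (A B : Set Ω),
    MeasurableSet[past X k] A ∧ MeasurableSet[future X (k + n)] B ∧
      x = |P.real (A ∩ B) - P.real A * P.real B|} :=
  ⟨1, by rintro x ⟨k, A, B, -, -, rfl⟩; exact abs_measureReal_inter_sub_le_one A B⟩

lemma abs_sub_le_mixingCoeff {n k : ℕ} {A B : Set Ω} (hA : MeasurableSet[past X k] A)
    (hB : MeasurableSet[future X (k + n)] B) :
    |P.real (A ∩ B) - P.real A * P.real B| ≤ mixingCoeff P X n :=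
  le_csSup (bddAbove_mixing P X n) ⟨k, A, B, hA, hB, rfl⟩

lemma mixingCoeff_nonneg (n : ℕ) : 0 ≤ mixingCoeff P X n :=
  (abs_nonneg _).trans
    (abs_sub_le_mixingCoeff (k := 0) (@MeasurableSet.empty _ (past X 0))
      (@MeasurableSet.empty _ (future X (0 + n))))

lemma mixingCoeff_le_one (n : ℕ) : mixingCoeff P X n ≤ 1 :=
  Real.sSup_le (by rintro x ⟨k, A, B, -, -, rfl⟩; exact abs_measureReal_inter_sub_le_one A B)
    zero_le_one

lemma mixingCoeff_antitone : Antitone (mixingCoeff P X) := by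
  intro m n hmn
  refine Real.sSup_le ?_ (mixingCoeff_nonneg m)
  rintro x ⟨k, A, B, hA, hB, rfl⟩
  exact abs_sub_le_mixingCoeff hA (future_antitone (by lia) _ hB)

/-- A bounded function of the process at two times at distance `d` has covariance of order
`α(d)`. -/
lemma abs_cov_le_mixingCoeff (hX : ∀ j, Measurable (X j)) {f : ℝ → ℝ} (hf : Measurable f)
    {b : ℝ} (hb : 0 < b) (hfb : ∀ x, |f x| ≤ b) (i d : ℕ) :
    |cov[fun ω => f (X i ω), fun ω => f (X (i + d) ω); P]| ≤ 4 * b ^ 2 * mixingCoeff P X d := by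
  have hL (j : ℕ) : MemLp (fun ω => f (X j ω)) 2 P :=
    MemLp.of_bound (hf.comp (hX j)).aestronglyMeasurable b (ae_of_all _ fun ω => hfb _)
  have hI (j : ℕ) : Integrable (fun ω => f (X j ω)) P := (hL j).integrable (by norm_num)
  -- rescale to values in `[0, 1]`
  let g : ℝ → ℝ := fun x => (f x + b) / (2 * b)
  have hg : Measurable g := by fun_prop
  have hg0 (x : ℝ) : 0 ≤ g x := div_nonneg (by linarith [(abs_le.1 (hfb x)).1]) (by linarith)
  have hg1 (x : ℝ) : g x ≤ 1 := (div_le_one (by linarith)).2 (by linarith [(abs_le.1 (hfb x)).2])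
  have key := abs_integral_mul_sub_le P (past_le hX i) (future_le hX (i + d))
    (fun A B hA hB => abs_sub_le_mixingCoeff hA hB)
    (hg.comp (measurable_past (X := X) le_rfl)) (hg.comp (measurable_future (X := X) le_rfl))
    (fun ω => hg0 _) (fun ω => hg1 _) (fun ω => hg0 _) (fun ω => hg1 _)
  have hEg (j : ℕ) : ∫ ω, g (X j ω) ∂P = (∫ ω, f (X j ω) ∂P + b) / (2 * b) := by
    simp only [g]
    rw [integral_div, integral_add (hI j) (integrable_const _)]
    simp
  have hP : Integrable (fun ω => f (X i ω) * f (X (i + d) ω)) P := (hL i).integrable_mul (hL _)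
  have hEgg : ∫ ω, g (X i ω) * g (X (i + d) ω) ∂P = (∫ ω, f (X i ω) * f (X (i + d) ω) ∂P
      + b * ∫ ω, f (X i ω) ∂P + b * ∫ ω, f (X (i + d) ω) ∂P + b ^ 2) / (2 * b) ^ 2 := by
    have : ∀ ω, g (X i ω) * g (X (i + d) ω) = (f (X i ω) * f (X (i + d) ω)
        + b * f (X i ω) + b * f (X (i + d) ω) + b ^ 2) / (2 * b) ^ 2 := by
      intro ω
      simp only [g]
      field_simp
      ring
    simp_rw [this]
    rw [integral_div, integral_add _ (integrable_const _), integral_add _ ((hI _).const_mul b),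
      integral_add hP ((hI _).const_mul b), integral_const_mul, integral_const_mul]
    · simp
    · exact hP.add ((hI _).const_mul b)
    · exact (hP.add ((hI _).const_mul b)).add ((hI _).const_mul b)
  rw [covariance_eq_sub (hL i) (hL (i + d))]
  simp only [Function.comp_apply] at key
  rw [hEgg, hEg, hEg] at key
  have e : ∀ p q s : ℝ, (p + b * q + b * s + b ^ 2) / (2 * b) ^ 2
      - (q + b) / (2 * b) * ((s + b) / (2 * b)) = (p - q * s) / (4 * b ^ 2) := by
    intro p q s
    field_simp
    ring
  rw [e, abs_div, abs_of_pos (by positivity : 0 < 4 * b ^ 2), div_le_iff₀ (by positivity)] at key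
  simp only [Pi.mul_apply]
  linarith

/-- The variance of a block sum grows at most linearly in the length of the block. -/
lemma variance_sum_le (hX : ∀ j, Measurable (X j)) (hs : Summable (mixingCoeff P X))
    {f : ℝ → ℝ} (hf : Measurable f) {b : ℝ} (hb : 0 < b) (hfb : ∀ x, |f x| ≤ b) (a p : ℕ) :
    Var[fun ω => ∑ j ∈ Finset.Ico a (a + p), f (X j ω); P]
      ≤ p * (8 * b ^ 2 * ∑' n, mixingCoeff P X n) := by
  have hL (j : ℕ) : MemLp (fun ω => f (X j ω)) 2 P :=
    MemLp.of_bound (hf.comp (hX j)).aestronglyMeasurable b (ae_of_all _ fun ω => hfb _)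
  rw [variance_fun_sum' fun j _ => hL j]
  have hrow : ∀ i ∈ Finset.Ico a (a + p), ∑ j ∈ Finset.Ico a (a + p),
      cov[fun ω => f (X i ω), fun ω => f (X j ω); P] ≤ 8 * b ^ 2 * ∑' n, mixingCoeff P X n := by
    intro i _
    have hpt : ∀ j ∈ Finset.Ico a (a + p), cov[fun ω => f (X i ω), fun ω => f (X j ω); P] ≤
        4 * b ^ 2 * ((if i ≤ j then mixingCoeff P X (j - i) else 0) +
          (if j ≤ i then mixingCoeff P X (i - j) else 0)) := by
      intro j _
      have hn := mixingCoeff_nonneg (P := P) (X := X)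
      rcases le_total i j with h | h
      · obtain ⟨d, rfl⟩ := Nat.exists_eq_add_of_le h
        refine (le_abs_self _).trans ((abs_cov_le_mixingCoeff hX hf hb hfb i d).trans ?_)
        gcongr
        simp only [h, if_true, Nat.add_sub_cancel_left]
        have : 0 ≤ if i + d ≤ i then mixingCoeff P X (i - (i + d)) else 0 := by
          split_ifs <;> simp [hn]
        linarith
      · obtain ⟨d, rfl⟩ := Nat.exists_eq_add_of_le h
        rw [covariance_comm]
        refine (le_abs_self _).trans ((abs_cov_le_mixingCoeff hX hf hb hfb j d).trans ?_)
        gcongr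
        simp only [h, if_true, Nat.add_sub_cancel_left]
        have : 0 ≤ if j + d ≤ j then mixingCoeff P X (j - (j + d)) else 0 := by
          split_ifs <;> simp [hn]
        linarith
    refine (Finset.sum_le_sum hpt).trans ?_
    rw [← Finset.mul_sum, Finset.sum_add_distrib]
    have h1 : ∑ j ∈ Finset.Ico a (a + p), (if i ≤ j then mixingCoeff P X (j - i) else 0)
        ≤ ∑' n, mixingCoeff P X n := by
      rw [← Finset.sum_filter, ← Finset.sum_image (f := mixingCoeff P X) (g := fun j => j - i)]
      · exact hs.sum_le_tsum _ fun n _ => mixingCoeff_nonneg n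
      · intro x hx y hy hxy
        simp only [Finset.coe_filter, Set.mem_ofPred_eq] at hx hy hxy
        lia
    have h2 : ∑ j ∈ Finset.Ico a (a + p), (if j ≤ i then mixingCoeff P X (i - j) else 0)
        ≤ ∑' n, mixingCoeff P X n := by
      rw [← Finset.sum_filter, ← Finset.sum_image (f := mixingCoeff P X) (g := fun j => i - j)]
      · exact hs.sum_le_tsum _ fun n _ => mixingCoeff_nonneg n
      · intro x hx y hy hxy
        simp only [Finset.coe_filter, Set.mem_ofPred_eq] at hx hy hxy
        lia
    calc _ ≤ 4 * b ^ 2 * (∑' n, mixingCoeff P X n + ∑' n, mixingCoeff P X n) := by gcongr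
      _ = _ := by ring
  calc _ ≤ ∑ _i ∈ Finset.Ico a (a + p), 8 * b ^ 2 * ∑' n, mixingCoeff P X n :=
        Finset.sum_le_sum hrow
    _ = _ := by simp

end Mixing

/-! ### Partial sums of a bounded function of a mixing process -/

lemma sum_range_mul_eq_sum_blocks (x : ℕ → ℝ) (m p : ℕ) :
    ∑ j ∈ Finset.range (m * p), x j
      = ∑ i ∈ Finset.range m, ∑ j ∈ Finset.Ico (i * p) (i * p + p), x j := by
  induction m with
  | zero => simp
  | succ m ih =>
    rw [Finset.sum_range_succ, ← ih, Finset.range_eq_Ico, Finset.range_eq_Ico,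
      Finset.sum_Ico_consecutive _ (Nat.zero_le _) (Nat.le_add_right _ _), Nat.succ_mul]

/-- If no two non-adjacent blocks have a low sum, at most two blocks have one, and these cost at
most `2 p (a + b)`. -/
lemma le_sum_of_low_blocks_adjacent {x : ℕ → ℝ} {a b : ℝ} (hxb : ∀ j, |x j| ≤ b) (ha : 0 ≤ a)
    {m p n : ℕ} (hn : m * p ≤ n)
    (h : ∀ i j, i < m → j < m → i + 2 ≤ j →
      ∑ k ∈ Finset.Ico (i * p) (i * p + p), x k ≤ p * a →
      ¬ ∑ k ∈ Finset.Ico (j * p) (j * p + p), x k ≤ p * a) :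
    m * p * a - 2 * p * (a + b) - (n - m * p) * b ≤ ∑ j ∈ Finset.range n, x j := by
  classical
  have hb : 0 ≤ b := (abs_nonneg _).trans (hxb 0)
  set Z : ℕ → ℝ := fun i => ∑ k ∈ Finset.Ico (i * p) (i * p + p), x k
  set low := (Finset.range m).filter fun i => Z i ≤ p * a with hlow
  have hcard : low.card ≤ 2 := by
    by_contra hc
    obtain ⟨i, j, k, hi, hj, hk, hij, hik, hjk⟩ := Finset.two_lt_card_iff.1 (not_le.1 hc)
    simp only [hlow, Finset.mem_filter, Finset.mem_range] at hi hj hk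
    have hadj : ∀ i j, (i < m ∧ Z i ≤ p * a) → (j < m ∧ Z j ≤ p * a) → ¬ i + 2 ≤ j :=
      fun i j hi hj hij => h i j hi.1 hj.1 hij hi.2 hj.2
    have h1 := hadj i j hi hj
    have h2 := hadj j i hj hi
    have h3 := hadj i k hi hk
    have h4 := hadj k i hk hi
    have h5 := hadj j k hj hk
    have h6 := hadj k j hk hj
    lia
  have hZlow (i : ℕ) : (p * a - (if Z i ≤ p * a then p * (a + b) else 0) : ℝ) ≤ Z i := by
    split_ifs with hi
    · have : ∑ _k ∈ Finset.Ico (i * p) (i * p + p), (-b) ≤ Z i :=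
        Finset.sum_le_sum fun k _ => (abs_le.1 (hxb k)).1
      simp only [Finset.sum_const, Nat.card_Ico, Nat.add_sub_cancel_left, nsmul_eq_mul] at this
      linarith
    · linarith
  have h1 : m * p * a - 2 * p * (a + b) ≤ ∑ j ∈ Finset.range (m * p), x j := by
    rw [sum_range_mul_eq_sum_blocks]
    refine le_trans ?_ (Finset.sum_le_sum fun i _ => hZlow i)
    rw [Finset.sum_sub_distrib, ← Finset.sum_filter]
    simp only [Finset.sum_const, Finset.card_range, nsmul_eq_mul]
    have hc : (low.card : ℝ) ≤ 2 := by exact_mod_cast hcard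
    have : (low.card : ℝ) * (p * (a + b)) ≤ 2 * (p * (a + b)) := by gcongr
    linarith
  have h2 : -((n - m * p) * b) ≤ ∑ j ∈ Finset.Ico (m * p) n, x j := by
    have : ∑ _k ∈ Finset.Ico (m * p) n, (-b) ≤ ∑ j ∈ Finset.Ico (m * p) n, x j :=
      Finset.sum_le_sum fun k _ => (abs_le.1 (hxb k)).1
    simp only [Finset.sum_const, Nat.card_Ico, nsmul_eq_mul, Nat.cast_sub hn, Nat.cast_mul] at this
    linarith
  rw [← Finset.sum_range_add_sum_Ico _ hn]
  linarith

section

variable {Ω : Type*} [mΩ : MeasurableSpace Ω] {P : Measure Ω} [IsProbabilityMeasure P]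
  {X : ℕ → Ω → ℝ}

/-- Chebyshev's inequality for one block. -/
lemma measureReal_block_le (hX : ∀ j, Measurable (X j)) (hs : Summable (mixingCoeff P X))
    {f : ℝ → ℝ} (hf : Measurable f) {b : ℝ} (hb : 0 < b) (hfb : ∀ x, |f x| ≤ b) {μ : ℝ}
    (hμ : ∀ j, ∫ ω, f (X j ω) ∂P = μ) {δ : ℝ} (hδ : 0 < δ) (a : ℕ) {p : ℕ} (hp : 0 < p) :
    P.real {ω | ∑ j ∈ Finset.Ico a (a + p), f (X j ω) ≤ p * (μ - δ)}
      ≤ 8 * b ^ 2 * (∑' n, mixingCoeff P X n) / (p * δ ^ 2) := by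
  have hL (j : ℕ) : MemLp (fun ω => f (X j ω)) 2 P :=
    MemLp.of_bound (hf.comp (hX j)).aestronglyMeasurable b (ae_of_all _ fun ω => hfb _)
  have hp' : (0 : ℝ) < p := by exact_mod_cast hp
  have hE : ∫ ω, ∑ j ∈ Finset.Ico a (a + p), f (X j ω) ∂P = p * μ := by
    rw [integral_finsetSum _ fun j _ => (hL j).integrable (by norm_num)]
    simp [hμ]
  have hS : 0 ≤ ∑' n, mixingCoeff P X n := tsum_nonneg mixingCoeff_nonneg
  have key := meas_ge_le_variance_div_sq (μ := P)
    (memLp_finsetSum (Finset.Ico a (a + p)) fun j _ => hL j) (mul_pos hp' hδ)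
  rw [hE] at key
  have hsub : {ω | ∑ j ∈ Finset.Ico a (a + p), f (X j ω) ≤ p * (μ - δ)} ⊆
      {ω | p * δ ≤ |∑ j ∈ Finset.Ico a (a + p), f (X j ω) - p * μ|} := by
    intro ω hω
    simp only [Set.mem_ofPred_eq] at hω ⊢
    rw [abs_sub_comm]
    exact le_trans (by linarith) (le_abs_self _)
  have hv := variance_sum_le (P := P) hX hs hf hb hfb a p
  rw [measureReal_def]
  refine ENNReal.toReal_le_of_le_ofReal (by positivity) ((measure_mono hsub).trans (key.trans ?_))
  refine ENNReal.ofReal_le_ofReal ?_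
  rw [div_le_div_iff₀ (by positivity) (by positivity)]
  calc _ ≤ (p * (8 * b ^ 2 * ∑' n, mixingCoeff P X n)) * (p * δ ^ 2) := by gcongr
    _ = _ := by ring

/-- The partial sums fall below the level of `le_sum_of_low_blocks_adjacent` only if two
non-adjacent blocks are low. As these are separated by a gap of length `p`, the probability is at
most the number of pairs times the square of the Chebyshev bound plus `α(p)`. -/
lemma measureReal_sum_lt_le (hX : ∀ j, Measurable (X j)) (hs : Summable (mixingCoeff P X))
    {f : ℝ → ℝ} (hf : Measurable f) {b : ℝ} (hb : 0 < b) (hfb : ∀ x, |f x| ≤ b) {μ : ℝ}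
    (hμ : ∀ j, ∫ ω, f (X j ω) ∂P = μ) {δ : ℝ} (hδ : 0 < δ) (hδμ : δ ≤ μ) {m p n : ℕ}
    (hp : 0 < p) (hn : m * p ≤ n) :
    P.real {ω | ∑ j ∈ Finset.range n, f (X j ω)
        < m * p * (μ - δ) - 2 * p * (μ - δ + b) - (n - m * p) * b}
      ≤ m ^ 2 * ((8 * b ^ 2 * (∑' n, mixingCoeff P X n) / (p * δ ^ 2)) ^ 2
        + mixingCoeff P X p) := by
  set q := 8 * b ^ 2 * (∑' n, mixingCoeff P X n) / (p * δ ^ 2)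
  let low : ℕ → Set Ω := fun i =>
    {ω | ∑ k ∈ Finset.Ico (i * p) (i * p + p), f (X k ω) ≤ p * (μ - δ)}
  have hpair : ∀ i j, i + 2 ≤ j → P.real (low i ∩ low j) ≤ q ^ 2 + mixingCoeff P X p := by
    intro i j hij
    have hA : MeasurableSet[past X (i * p + p)] (low i) := by
      have : Measurable[past X (i * p + p)]
          fun ω => ∑ k ∈ Finset.Ico (i * p) (i * p + p), f (X k ω) :=
        Finset.measurable_fun_sum _ fun k hk =>
          hf.comp (measurable_past (Finset.mem_Ico.1 hk).2.le)
      exact this measurableSet_Iic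
    have hB : MeasurableSet[future X (i * p + p + p)] (low j) := by
      have : Measurable[future X (i * p + p + p)]
          fun ω => ∑ k ∈ Finset.Ico (j * p) (j * p + p), f (X k ω) := by
        refine Finset.measurable_fun_sum _ fun k hk =>
          hf.comp (measurable_future (le_trans ?_ (Finset.mem_Ico.1 hk).1))
        calc i * p + p + p = (i + 2) * p := by ring
          _ ≤ j * p := Nat.mul_le_mul_right p hij
      exact this measurableSet_Iic
    have h1 := (le_abs_self _).trans (abs_sub_le_mixingCoeff (P := P) hA hB)
    have h2 : P.real (low i) * P.real (low j) ≤ q * q :=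
      mul_le_mul (measureReal_block_le hX hs hf hb hfb hμ hδ _ hp)
        (measureReal_block_le hX hs hf hb hfb hμ hδ _ hp) measureReal_nonneg
        (measureReal_nonneg.trans (measureReal_block_le hX hs hf hb hfb hμ hδ (i * p) hp))
    nlinarith
  have hr : 0 ≤ q ^ 2 + mixingCoeff P X p := add_nonneg (sq_nonneg _) (mixingCoeff_nonneg _)
  let pairs := (Finset.range m ×ˢ Finset.range m).filter fun ij => ij.1 + 2 ≤ ij.2
  have hsub : {ω | ∑ j ∈ Finset.range n, f (X j ω)
      < m * p * (μ - δ) - 2 * p * (μ - δ + b) - (n - m * p) * b} ⊆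
      ⋃ ij ∈ pairs, low ij.1 ∩ low ij.2 := by
    intro ω hω
    by_contra hcon
    refine absurd hω (not_lt.2 (le_sum_of_low_blocks_adjacent (fun j => hfb (X j ω))
      (by linarith) hn ?_))
    intro i j hi hj hij h1 h2
    refine hcon (Set.mem_iUnion₂.2 ⟨(i, j), ?_, h1, h2⟩)
    simp [pairs, hi, hj, hij]
  calc _ ≤ P.real (⋃ ij ∈ pairs, low ij.1 ∩ low ij.2) := measureReal_mono hsub (measure_ne_top _ _)
    _ ≤ ∑ ij ∈ pairs, P.real (low ij.1 ∩ low ij.2) := measureReal_biUnion_finset_le _ _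
    _ ≤ ∑ _ij ∈ pairs, (q ^ 2 + mixingCoeff P X p) :=
        Finset.sum_le_sum fun ij hij => hpair _ _ (Finset.mem_filter.1 hij).2
    _ = pairs.card * (q ^ 2 + mixingCoeff P X p) := by rw [Finset.sum_const, nsmul_eq_mul]
    _ ≤ _ := by
        gcongr
        have : pairs.card ≤ m ^ 2 := (Finset.card_filter_le _ _).trans (by simp [sq])
        exact_mod_cast this

end

/-! ### Truncation -/

/-- The value `y` cut off at the levels `-b` and `b`. -/
noncomputable def truncate (b y : ℝ) : ℝ := max (-b) (min b y)

lemma abs_truncate_le {b : ℝ} (hb : 0 ≤ b) (y : ℝ) : |truncate b y| ≤ b :=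
  abs_le.2 ⟨le_max_left _ _, max_le (by linarith) (min_le_left _ _)⟩

lemma abs_truncate_le_abs {b : ℝ} (hb : 0 ≤ b) (y : ℝ) : |truncate b y| ≤ |y| := by
  refine abs_le.2 ⟨?_, max_le (by linarith [abs_nonneg y])
    ((min_le_right _ _).trans (le_abs_self y))⟩
  refine le_trans ?_ (le_max_right _ _)
  exact le_min (by linarith [abs_nonneg y]) (neg_abs_le y)

lemma truncate_eq_self {b y : ℝ} (h : |y| ≤ b) : truncate b y = y := by
  rw [abs_le] at h
  rw [truncate, min_eq_right h.2, max_eq_right h.1]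

@[fun_prop]
lemma measurable_truncate (b : ℝ) : Measurable (truncate b) := by
  unfold truncate
  fun_prop

lemma tendsto_integral_truncate {Ω : Type*} [MeasurableSpace Ω] {P : Measure Ω} {Y : Ω → ℝ}
    (hY : Integrable Y P) {b : ℕ → ℝ} (hb0 : ∀ n, 0 ≤ b n) (hb : Tendsto b atTop atTop) :
    Tendsto (fun n => ∫ ω, truncate (b n) (Y ω) ∂P) atTop (𝓝 (∫ ω, Y ω ∂P)) := by
  refine tendsto_integral_of_dominated_convergence (fun ω => |Y ω|) (fun n => ?_) hY.abs
    (fun n => ae_of_all _ fun ω => abs_truncate_le_abs (hb0 n) _) (ae_of_all _ fun ω => ?_)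
  · exact ((measurable_truncate (b n)).comp_aemeasurable hY.aemeasurable).aestronglyMeasurable
  · refine tendsto_const_nhds.congr' ?_
    filter_upwards [hb.eventually_ge_atTop |Y ω|] with n hn
    rw [truncate_eq_self hn]

/-! ### Block lengths and summability of the error terms -/

/-- The sizes obtained by cutting `n` indices into `⌈b²⌉` blocks of equal length. -/
lemma block_size_bounds {b : ℝ} (hb : 1 ≤ b) {n : ℕ} (hn : 4 * b ^ 2 ≤ n) :
    0 < n / ⌈b ^ 2⌉₊ ∧ (⌈b ^ 2⌉₊ : ℝ) ≤ 2 * b ^ 2 ∧ ⌈b ^ 2⌉₊ * (n / ⌈b ^ 2⌉₊) ≤ n ∧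
      (n : ℝ) ≤ 4 * b ^ 2 * (n / ⌈b ^ 2⌉₊ : ℕ) ∧
      (n : ℝ) - ⌈b ^ 2⌉₊ * (n / ⌈b ^ 2⌉₊ : ℕ) ≤ 2 * b ^ 2 ∧
      b ^ 2 * (n / ⌈b ^ 2⌉₊ : ℕ) ≤ n := by
  have hb2 : 1 ≤ b ^ 2 := one_le_pow₀ hb
  set m := ⌈b ^ 2⌉₊ with hm
  set p := n / m with hp
  have hm1 : b ^ 2 ≤ m := Nat.le_ceil _
  have hm2 : (m : ℝ) ≤ 2 * b ^ 2 := by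
    have := Nat.ceil_lt_add_one (zero_le_one.trans hb2)
    linarith
  have hm0 : 0 < m := Nat.ceil_pos.2 (by linarith)
  have h1 : m * p ≤ n := Nat.mul_div_le n m
  have h2 : n < m * (p + 1) := Nat.lt_mul_div_succ n hm0
  have h1' : (m : ℝ) * p ≤ n := by exact_mod_cast h1
  have h2' : (n : ℝ) < m * (p + 1) := by exact_mod_cast h2
  have hmn : m ≤ n := by exact_mod_cast (by linarith : (m : ℝ) ≤ n)
  have hp0 : 0 < p := Nat.div_pos hmn hm0
  have hp1 : (1 : ℝ) ≤ p := by exact_mod_cast hp0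
  refine ⟨hp0, hm2, h1, ?_, by linarith, ?_⟩
  · calc (n : ℝ) ≤ m * (p + 1) := h2'.le
      _ ≤ 2 * b ^ 2 * (p + p) := by gcongr
      _ = 4 * b ^ 2 * p := by ring
  · exact (mul_le_mul_of_nonneg_right hm1 (by linarith)).trans h1'

lemma summable_mul_exp_neg_rpow {η κ : ℝ} (hη : 0 < η) (hκ : 0 < κ) :
    Summable fun n : ℕ => (n : ℝ) * Real.exp (-η * (n : ℝ) ^ κ) := by
  have h1 := (isLittleO_exp_neg_mul_rpow_atTop hη (-3 / κ)).comp_tendsto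
    ((tendsto_rpow_atTop hκ).comp tendsto_natCast_atTop_atTop)
  have h2 := (Asymptotics.isBigO_refl (fun n : ℕ => (n : ℝ)) atTop).mul h1.isBigO
  refine summable_of_isBigO_nat (g := fun n : ℕ => (n : ℝ) ^ (-2 : ℝ))
    (Real.summable_nat_rpow.2 (by norm_num)) (h2.congr' (by rfl) ?_)
  filter_upwards [eventually_gt_atTop 0] with n hn
  have hn' : (0 : ℝ) < n := by exact_mod_cast hn
  simp only [Function.comp_apply]
  rw [← Real.rpow_mul hn'.le, mul_div_cancel₀ _ hκ.ne', ← Real.rpow_one_add' hn'.le (by norm_num)]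
  norm_num

/-- An antitone sequence whose `r`-th roots are summable is `O(n ^ (-r))`. -/
lemma exists_le_div_rpow {α : ℕ → ℝ} (h0 : ∀ n, 0 ≤ α n) (hα : Antitone α) {r : ℝ} (hr : 1 < r)
    (hs : Summable fun n => α (n + 1) ^ (1 / r)) :
    ∃ A : ℝ, 0 ≤ A ∧ ∀ n : ℕ, 0 < n → α n ≤ (A / n) ^ r := by
  refine ⟨∑' n, α (n + 1) ^ (1 / r), tsum_nonneg fun n => Real.rpow_nonneg (h0 _) _, ?_⟩
  intro n hn
  have hn' : (0 : ℝ) < n := by exact_mod_cast hn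
  have h1 : n * α n ^ (1 / r) ≤ ∑' n, α (n + 1) ^ (1 / r) := by
    refine le_trans ?_ (hs.sum_le_tsum (Finset.range n) fun k _ => Real.rpow_nonneg (h0 _) _)
    calc n * α n ^ (1 / r) = ∑ _k ∈ Finset.range n, α n ^ (1 / r) := by simp
      _ ≤ _ := Finset.sum_le_sum fun k hk => Real.rpow_le_rpow (h0 _)
        (hα (Finset.mem_range.1 hk)) (by positivity)
  rw [mul_comm, ← le_div_iff₀ hn'] at h1
  calc α n = (α n ^ (1 / r)) ^ r := by
        rw [← Real.rpow_mul (h0 n), one_div_mul_cancel (by linarith), Real.rpow_one]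
    _ ≤ _ := Real.rpow_le_rpow (Real.rpow_nonneg (h0 n) _) h1 (by linarith)

lemma summable_of_summable_rpow {α : ℕ → ℝ} (h0 : ∀ n, 0 ≤ α n) (h1 : ∀ n, α n ≤ 1) {r : ℝ}
    (hr : 1 < r) (hs : Summable fun n => α (n + 1) ^ (1 / r)) : Summable α := by
  rw [← summable_nat_add_iff 1]
  refine Summable.of_nonneg_of_le (fun n => h0 _) (fun n => ?_) hs
  exact Real.self_le_rpow_of_le_one (h0 _) (h1 _) ((div_le_one (by linarith)).2 hr.le)

/-- Below the mean by a fixed amount, the block level dominates `c n`: the two low blocks, the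
incomplete block and the truncation cost `O(b³ + n / b)`. -/
lemma eventually_le_block_level {Γ c δ κ : ℝ} (hκ0 : 0 < κ) (hκ : κ < 1 / 3) (hc : c < Γ - δ)
    {μ : ℕ → ℝ} (hμ : Tendsto μ atTop (𝓝 Γ)) (hδ : 0 < δ) (hμb : ∀ n : ℕ, μ n ≤ (n : ℝ) ^ κ) :
    ∀ᶠ n : ℕ in atTop, ∀ m p : ℕ, m * p ≤ n →
      (n : ℝ) - m * p ≤ 2 * ((n : ℝ) ^ κ) ^ 2 → ((n : ℝ) ^ κ) ^ 2 * p ≤ n →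
      c * n ≤ m * p * (μ n - δ) - 2 * p * (μ n - δ + (n : ℝ) ^ κ) - (n - m * p) * (n : ℝ) ^ κ := by
  have hlim : Tendsto (fun n : ℕ => μ n - δ - 4 * ((n : ℝ) ^ (-(1 - 3 * κ)) + (n : ℝ) ^ (-κ)))
      atTop (𝓝 (Γ - δ - 4 * (0 + 0))) :=
    (hμ.sub_const δ).sub (((((tendsto_rpow_neg_atTop (by linarith)).comp
      tendsto_natCast_atTop_atTop).add
        ((tendsto_rpow_neg_atTop hκ0).comp tendsto_natCast_atTop_atTop))).const_mul 4)
  filter_upwards [hlim.eventually_const_lt (by linarith : c < Γ - δ - 4 * (0 + 0)),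
    eventually_gt_atTop 0] with n hn hn0 m p hmp h1 h2
  have hn' : (0 : ℝ) < n := by exact_mod_cast hn0
  have hb : 0 < (n : ℝ) ^ κ := Real.rpow_pos_of_pos hn' _
  have e1 : n * (n : ℝ) ^ (-(1 - 3 * κ)) = ((n : ℝ) ^ κ) ^ 3 := by
    rw [← Real.rpow_natCast, ← Real.rpow_mul hn'.le]
    nth_rewrite 1 [← Real.rpow_one (n : ℝ)]
    rw [← Real.rpow_add hn']
    congr 1
    push_cast
    ring
  have e2 : n * (n : ℝ) ^ (-κ) = n / (n : ℝ) ^ κ := by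
    rw [Real.rpow_neg hn'.le, div_eq_mul_inv]
  have hab := hμb n
  have hmp' : (m : ℝ) * p ≤ n := by exact_mod_cast hmp
  have hp : (p : ℝ) * (n : ℝ) ^ κ ≤ n / (n : ℝ) ^ κ := by
    rw [le_div_iff₀ hb]
    linarith
  have hcn : c * n ≤ n * (μ n - δ) - 4 * (((n : ℝ) ^ κ) ^ 3 + n / (n : ℝ) ^ κ) := by
    rw [← e1, ← e2]
    nlinarith
  generalize (n : ℝ) ^ κ = b at *
  have hd : (n - m * p) * (μ n - δ + b) ≤ 2 * b ^ 2 * (2 * b) := by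
    calc (n - m * p) * (μ n - δ + b) ≤ (n - m * p : ℝ) * (2 * b) := by
          gcongr; linarith
      _ ≤ _ := by gcongr
  have hd2 : (p : ℝ) * (μ n - δ + b) ≤ 2 * (p * b) := by
    calc (p : ℝ) * (μ n - δ + b) ≤ p * (2 * b) := by gcongr; linarith
      _ = _ := by ring
  nlinarith

/-! ### Lower deviations of the partial sums -/

lemma IsStationary.identDistrib {Ω : Type*} [MeasurableSpace Ω] {P : Measure Ω} {X : ℕ → Ω → ℝ}
    (h : IsStationary P X) (j : ℕ) : IdentDistrib (X j) (X 0) P P := by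
  have := (h j).comp (u := fun x : ℕ → ℝ => x 0) (measurable_pi_apply 0)
  simpa [Function.comp_def] using this

/-- The explicit upper bound for the probability that the truncated block sums are low. -/
lemma block_bound_le {n m p : ℕ} {κ r A S δ a : ℝ} (hn : 0 < n) (hp : 0 < p) (hr : 1 < r)
    (hA : 0 ≤ A) (hS : 0 ≤ S) (hδ : 0 < δ) (hm : (m : ℝ) ≤ 2 * ((n : ℝ) ^ κ) ^ 2)
    (hnp : (n : ℝ) ≤ 4 * ((n : ℝ) ^ κ) ^ 2 * p) (ha0 : 0 ≤ a) (ha : a ≤ (A / p) ^ r) :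
    m ^ 2 * ((8 * ((n : ℝ) ^ κ) ^ 2 * S / (p * δ ^ 2)) ^ 2 + a)
      ≤ 4 * (32 * S / δ ^ 2) ^ 2 * (n : ℝ) ^ (12 * κ - 2)
        + 4 * (4 * A) ^ r * (n : ℝ) ^ (4 * κ + 2 * κ * r - r) := by
  have hn' : (0 : ℝ) < n := by exact_mod_cast hn
  have hp' : (0 : ℝ) < p := by exact_mod_cast hp
  have hb : 0 < (n : ℝ) ^ κ := Real.rpow_pos_of_pos hn' _
  have e1 : (n : ℝ) ^ (12 * κ - 2) = ((n : ℝ) ^ κ) ^ 12 / n ^ 2 := by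
    rw [Real.rpow_sub hn', ← Real.rpow_natCast (n ^ κ), ← Real.rpow_mul hn'.le, mul_comm κ]
    norm_num
  have e2 : (n : ℝ) ^ (4 * κ + 2 * κ * r - r)
      = ((n : ℝ) ^ κ) ^ 4 * (((n : ℝ) ^ κ) ^ 2 / n) ^ r := by
    rw [Real.div_rpow (by positivity) hn'.le, Real.rpow_sub hn', Real.rpow_add hn',
      ← Real.rpow_natCast (n ^ κ), ← Real.rpow_natCast (n ^ κ), ← Real.rpow_mul hn'.le,
      ← Real.rpow_mul hn'.le, ← Real.rpow_mul hn'.le, mul_div_assoc]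
    norm_num [mul_comm κ]
  rw [e1, e2]
  generalize (n : ℝ) ^ κ = b at *
  have hpinv : 1 / (p : ℝ) ≤ 4 * b ^ 2 / n := by
    rw [div_le_div_iff₀ hp' hn']
    linarith
  have hq : 8 * b ^ 2 * S / (p * δ ^ 2) ≤ (32 * S / δ ^ 2) * (b ^ 4 / n) := by
    calc 8 * b ^ 2 * S / (p * δ ^ 2) = 8 * b ^ 2 * S / δ ^ 2 * (1 / p) := by field_simp
      _ ≤ 8 * b ^ 2 * S / δ ^ 2 * (4 * b ^ 2 / n) := by gcongr
      _ = _ := by ring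
  have ha' : a ≤ (4 * A) ^ r * (b ^ 2 / n) ^ r := by
    refine ha.trans ?_
    rw [← Real.mul_rpow (by positivity) (by positivity)]
    refine Real.rpow_le_rpow (by positivity) ?_ (by linarith)
    calc A / p = A * (1 / p) := by ring
      _ ≤ A * (4 * b ^ 2 / n) := by gcongr
      _ = _ := by ring
  calc _ ≤ (2 * b ^ 2) ^ 2 * ((32 * S / δ ^ 2 * (b ^ 4 / n)) ^ 2
        + (4 * A) ^ r * (b ^ 2 / n) ^ r) := by gcongr
    _ = _ := by ring

section

variable {Ω : Type*} [mΩ : MeasurableSpace Ω] {P : Measure Ω} [IsProbabilityMeasure P]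
  {X : ℕ → Ω → ℝ}

lemma measureReal_exists_lt_abs_le (hst : IsStationary P X) {h : ℝ → ℝ} (hh : Measurable h)
    {η : ℝ} (hη : 0 < η) (hexp : Integrable (fun ω => Real.exp (η * |h (X 0 ω)|)) P) (b : ℝ)
    (n : ℕ) :
    P.real {ω | ∃ j < n, b < |h (X j ω)|}
      ≤ n * (Real.exp (-η * b) * mgf (fun ω => |h (X 0 ω)|) P η) := by
  have h1 (j : ℕ) : P.real {ω | b < |h (X j ω)|}
      ≤ Real.exp (-η * b) * mgf (fun ω => |h (X 0 ω)|) P η := by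
    have e : P {ω | b < |h (X j ω)|} = P {ω | b < |h (X 0 ω)|} :=
      (hst.identDistrib j).measure_mem_eq (s := {x | b < |h x|})
        (measurableSet_lt measurable_const (by fun_prop))
    rw [measureReal_def, e, ← measureReal_def]
    refine le_trans (measureReal_mono ?_ (measure_ne_top _ _))
      (measure_ge_le_exp_mul_mgf b hη.le hexp)
    exact fun ω (hω : b < |h (X 0 ω)|) => hω.le
  have hsub : {ω | ∃ j < n, b < |h (X j ω)|} = ⋃ j ∈ Finset.range n, {ω | b < |h (X j ω)|} := by
    ext ω
    simp
  rw [hsub]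
  refine (measureReal_biUnion_finset_le _ _).trans ((Finset.sum_le_sum fun j _ => h1 j).trans ?_)
  simp

/-- The probability that the partial sums of a strongly mixing sequence with exponential moments
stay below a line of slope less than the mean is summable. Truncation happens at `n ^ κ`, with
`κ` so small that the powers of the truncation level do not spoil the decay `n ^ (-r)` of the
mixing coefficients. -/
theorem summable_measureReal_sum_lt (hX : ∀ j, Measurable (X j)) (hst : IsStationary P X)
    {r : ℝ} (hr : 1 < r) (hs : Summable fun n => mixingCoeff P X (n + 1) ^ (1 / r))
    {h : ℝ → ℝ} (hh : Measurable h) {η : ℝ} (hη : 0 < η)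
    (hexp : Integrable (fun ω => Real.exp (η * |h (X 0 ω)|)) P)
    (hint : Integrable (fun ω => h (X 0 ω)) P) {c : ℝ} (hc0 : 0 ≤ c)
    (hc : c < ∫ ω, h (X 0 ω) ∂P) :
    Summable fun n : ℕ => P.real {ω | ∑ j ∈ Finset.range n, h (X j ω) < c * n} := by
  set Γ := ∫ ω, h (X 0 ω) ∂P
  have hα0 := mixingCoeff_nonneg (P := P) (X := X)
  have hsum := summable_of_summable_rpow hα0 mixingCoeff_le_one hr hs
  obtain ⟨A, hA, hαA⟩ := exists_le_div_rpow hα0 mixingCoeff_antitone hr hs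
  set δ := (Γ - c) / 2 with hδdef
  have hδ : 0 < δ := by rw [hδdef]; linarith
  set κ := (r - 1) / (24 * r) with hκdef
  have hκ : 0 < κ := div_pos (by linarith) (by linarith)
  have hκr : 24 * (κ * r) = r - 1 := by
    rw [hκdef]
    field_simp
  have hκ24 : κ < 1 / 24 := by
    rw [hκdef, div_lt_div_iff₀ (by linarith) (by norm_num)]
    linarith
  have hb0 (n : ℕ) : 0 ≤ (n : ℝ) ^ κ := Real.rpow_nonneg n.cast_nonneg _
  have hbt : Tendsto (fun n : ℕ => (n : ℝ) ^ κ) atTop atTop :=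
    (tendsto_rpow_atTop hκ).comp tendsto_natCast_atTop_atTop
  set μ : ℕ → ℝ := fun n => ∫ ω, truncate ((n : ℝ) ^ κ) (h (X 0 ω)) ∂P
  have hμ : Tendsto μ atTop (𝓝 Γ) := tendsto_integral_truncate hint hb0 hbt
  have hμb (n : ℕ) : μ n ≤ (n : ℝ) ^ κ := by
    refine (le_abs_self _).trans ?_
    have := norm_integral_le_of_norm_le_const (μ := P) (C := (n : ℝ) ^ κ)
      (f := fun ω => truncate ((n : ℝ) ^ κ) (h (X 0 ω)))
      (ae_of_all P fun ω => abs_truncate_le (hb0 n) (h (X 0 ω)))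
    simpa using this
  set S := ∑' n, mixingCoeff P X n
  have hS : 0 ≤ S := tsum_nonneg hα0
  set K := mgf (fun ω => |h (X 0 ω)|) P η
  have hlevel := eventually_le_block_level hκ (by linarith) (by rw [hδdef]; linarith : c < Γ - δ)
    hμ hδ hμb
  have hroom : ∀ᶠ n : ℕ in atTop, 4 * ((n : ℝ) ^ κ) ^ 2 ≤ n := by
    have ht : Tendsto (fun n : ℕ => (n : ℝ) ^ (1 - 2 * κ)) atTop atTop :=
      (tendsto_rpow_atTop (by linarith)).comp tendsto_natCast_atTop_atTop
    filter_upwards [ht.eventually_ge_atTop 4, eventually_gt_atTop 0] with n hn hn0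
    have hn' : (0 : ℝ) < n := by exact_mod_cast hn0
    calc (4 * ((n : ℝ) ^ κ) ^ 2 : ℝ) ≤ (n : ℝ) ^ (1 - 2 * κ) * ((n : ℝ) ^ κ) ^ 2 := by gcongr
      _ = n := by
        rw [← Real.rpow_natCast, ← Real.rpow_mul hn'.le, ← Real.rpow_add hn',
          show 1 - 2 * κ + κ * (2 : ℕ) = 1 by push_cast; ring, Real.rpow_one]
  have hbound : Summable fun n : ℕ => K * (n * Real.exp (-η * (n : ℝ) ^ κ))
      + (4 * (32 * S / δ ^ 2) ^ 2 * (n : ℝ) ^ (12 * κ - 2)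
        + 4 * (4 * A) ^ r * (n : ℝ) ^ (4 * κ + 2 * κ * r - r)) := by
    refine ((summable_mul_exp_neg_rpow hη hκ).mul_left K).add
      (((Real.summable_nat_rpow.2 ?_).mul_left _).add ((Real.summable_nat_rpow.2 ?_).mul_left _))
    · linarith
    · nlinarith
  refine Summable.of_norm_bounded_eventually_nat hbound ?_
  filter_upwards [hlevel, hroom, eventually_gt_atTop 0, hbt.eventually_ge_atTop 1,
    hμ.eventually_const_lt (by rw [hδdef]; linarith : δ < Γ)] with n hlev hn4 hn0 hb1 hδμ
  rw [Real.norm_eq_abs, abs_of_nonneg measureReal_nonneg]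
  obtain ⟨hp0, hm, hmp, hnp, hrest, hpn⟩ := block_size_bounds hb1 hn4
  set m := ⌈((n : ℝ) ^ κ) ^ 2⌉₊
  set p := n / m
  have hmean (j : ℕ) : ∫ ω, truncate ((n : ℝ) ^ κ) (h (X j ω)) ∂P = μ n :=
    ((hst.identDistrib j).comp (u := fun x => truncate ((n : ℝ) ^ κ) (h x))
      (by fun_prop)).integral_eq
  have hmain := measureReal_sum_lt_le (P := P) hX hsum
    (f := fun x => truncate ((n : ℝ) ^ κ) (h x)) (by fun_prop)
    (by linarith : 0 < (n : ℝ) ^ κ) (fun x => abs_truncate_le (hb0 n) (h x)) hmean hδ hδμ.le hp0 hmp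
  have hsub : {ω | ∑ j ∈ Finset.range n, h (X j ω) < c * n} ⊆
      {ω | ∃ j < n, (n : ℝ) ^ κ < |h (X j ω)|} ∪
      {ω | ∑ j ∈ Finset.range n, truncate ((n : ℝ) ^ κ) (h (X j ω))
        < m * p * (μ n - δ) - 2 * p * (μ n - δ + (n : ℝ) ^ κ) - (n - m * p) * (n : ℝ) ^ κ} := by
    intro ω hω
    by_cases hex : ∃ j < n, (n : ℝ) ^ κ < |h (X j ω)|
    · exact Or.inl hex
    · right
      push Not at hex
      refine lt_of_lt_of_le ?_ (hlev m p hmp hrest hpn)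
      rw [Finset.sum_congr rfl fun j hj => truncate_eq_self (hex j (Finset.mem_range.1 hj))]
      exact hω
  refine (measureReal_mono hsub).trans ((measureReal_union_le _ _).trans (add_le_add ?_ ?_))
  · refine (measureReal_exists_lt_abs_le hst hh hη hexp _ n).trans (le_of_eq ?_)
    ring
  · exact hmain.trans
      (block_bound_le hn0 hp0 hr hA hS hδ hm hnp (hα0 p) (hαA p hp0))

end

/-! ### The detection time -/

/-- A time that is at most `ν + n` whenever `n ≥ N` lies outside `B` exceeds `ν + N` by at most the
number of elements of `B`. -/
lemma le_add_tsum_indicator {T : ℝ≥0∞} {ν N : ℕ} {B : Set ℕ}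
    (hT : ∀ n, N ≤ n → n ∉ B → T ≤ (ν + n : ℕ)) :
    T ≤ (ν + N : ℕ) + ∑' n, B.indicator (1 : ℕ → ℝ≥0∞) n := by
  classical
  have hcount : ∀ k, (∀ n, N ≤ n → n < N + k → n ∈ B) →
      (k : ℝ≥0∞) ≤ ∑' n, B.indicator (1 : ℕ → ℝ≥0∞) n := by
    intro k hk
    refine le_trans (le_of_eq ?_) (ENNReal.sum_le_tsum (Finset.Ico N (N + k)))
    rw [Finset.sum_congr rfl (g := fun _ => (1 : ℝ≥0∞)) fun n hn =>
      Set.indicator_of_mem (hk n (Finset.mem_Ico.1 hn).1 (Finset.mem_Ico.1 hn).2) _]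
    simp
  by_cases hex : ∃ k, N + k ∉ B
  · have hk := Nat.find_spec hex
    refine (hT _ (Nat.le_add_right _ _) hk).trans ?_
    rw [← add_assoc, Nat.cast_add (ν + N)]
    gcongr
    refine hcount _ fun n hn hnk => ?_
    obtain ⟨d, rfl⟩ := Nat.exists_eq_add_of_le hn
    exact not_not.1 (Nat.find_min hex (Nat.lt_of_add_lt_add_left hnk))
  · push Not at hex
    have htop : ∑' n, B.indicator (1 : ℕ → ℝ≥0∞) n = ∞ := by
      by_contra hne
      obtain ⟨k, hk⟩ := ENNReal.exists_nat_gt hne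
      refine absurd (hcount k fun n hn _ => ?_) (not_le.2 hk)
      obtain ⟨d, rfl⟩ := Nat.exists_eq_add_of_le hn
      exact hex d
    simp [htop]

lemma sum_Icc_one_eq_sum_range (u : ℕ → ℝ) (n : ℕ) :
    ∑ i ∈ Finset.Icc 1 n, u i = ∑ i ∈ Finset.range n, u (i + 1) := by
  induction n with
  | zero => simp
  | succ n ih => rw [Finset.sum_Icc_succ_top (by lia), Finset.sum_range_succ, ih]

lemma sum_Icc_one_add (u : ℕ → ℝ) (ν n : ℕ) :
    ∑ i ∈ Finset.Icc 1 (ν + n), u i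
      = ∑ i ∈ Finset.Icc 1 ν, u i + ∑ j ∈ Finset.range n, u (ν + 1 + j) := by
  rw [sum_Icc_one_eq_sum_range, sum_Icc_one_eq_sum_range, Finset.sum_range_add]
  congr 1
  refine Finset.sum_congr rfl fun j _ => ?_
  congr 1
  ring

lemma detectionTime_le {Ω : Type*} {P₀ : Measure ℝ} {lam : ℝ} {S : ℕ → Ω → ℝ} {τ : ℝ} (hτ : 0 < τ)
    {ω : Ω} {t : ℕ} (ht : 1 ≤ t)
    (h : Real.log τ ≤ ∑ i ∈ Finset.Icc 1 t, increment P₀ lam S i ω) :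
    detectionTime P₀ lam S τ ω ≤ t := by
  refine iInf₂_le t ⟨ht, ?_⟩
  rw [expProcess, ← Real.exp_sum]
  exact (Real.log_le_iff_le_exp hτ).1 h

lemma tsum_measure_lt_neg_mul_lt_top {Ω : Type*} [MeasurableSpace Ω] {P : Measure Ω}
    [IsProbabilityMeasure P] {F : Ω → ℝ} (hF : Integrable F P) {δ : ℝ} (hδ : 0 < δ) :
    ∑' n : ℕ, P {ω | F ω < -(δ * n)} < ∞ := by
  let _ : MeasureSpace Ω := ⟨P⟩
  refine lt_of_le_of_lt (ENNReal.tsum_le_tsum fun n => measure_mono ?_)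
    (tsum_prob_mem_Ioi_lt_top (X := fun ω => |F ω| / δ) (hF.abs.div_const δ)
      fun ω => div_nonneg (abs_nonneg _) hδ.le)
  intro ω hω
  simp only [Set.mem_ofPred_eq, Set.mem_Ioi] at hω ⊢
  rw [lt_div_iff₀ hδ]
  linarith [neg_le_abs (F ω)]

/-- If the post-change sums stay below the line of slope `c` at a summable rate, the mean detection
time exceeds `log τ / (c - δ)` by at most a constant. The event that the pre-change sum, which is
integrable, falls below `-δ n` has summable probability as well. -/
lemma exists_lintegral_detectionTime_le {Ω : Type*} [MeasurableSpace Ω] {P : Measure Ω}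
    [IsProbabilityMeasure P] {P₀ : Measure ℝ} {lam : ℝ} {S : ℕ → Ω → ℝ} {ν : ℕ}
    (hS : ∀ t, Measurable (increment P₀ lam S t))
    (hint : ∀ t, 1 ≤ t → Integrable (increment P₀ lam S t) P) {c δ : ℝ} (hδ : 0 < δ) (hδc : δ < c)
    (hsum : Summable fun n : ℕ =>
      P.real {ω | ∑ j ∈ Finset.range n, increment P₀ lam S (ν + 1 + j) ω < c * n}) :
    ∃ D : ℝ, ∀ τ : ℝ, 1 < τ → ∫⁻ ω, detectionTime P₀ lam S τ ω ∂P
      ≤ ENNReal.ofReal (Real.log τ / (c - δ) + D) := by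
  set F : Ω → ℝ := fun ω => ∑ i ∈ Finset.Icc 1 ν, increment P₀ lam S i ω with hF
  have hFm : Measurable F := Finset.measurable_fun_sum _ fun i _ => hS i
  have hFi : Integrable F P :=
    integrable_finsetSum _ fun i hi => hint i (Finset.mem_Icc.1 hi).1
  let B : ℕ → Set Ω := fun n =>
    {ω | ∑ j ∈ Finset.range n, increment P₀ lam S (ν + 1 + j) ω < c * n} ∪
      {ω | F ω < -(δ * n)}
  have hBm (n : ℕ) : MeasurableSet (B n) :=
    (measurableSet_lt (Finset.measurable_fun_sum _ fun j _ => hS _) measurable_const).union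
      (measurableSet_lt hFm measurable_const)
  have hBsum : ∑' n, P (B n) < ∞ := by
    refine lt_of_le_of_lt (ENNReal.tsum_le_tsum fun n => measure_union_le _ _) ?_
    rw [ENNReal.tsum_add]
    refine ENNReal.add_lt_top.2 ⟨?_, tsum_measure_lt_neg_mul_lt_top hFi hδ⟩
    simpa only [measureReal_def, ENNReal.ofReal_toReal (measure_ne_top _ _)] using
      hsum.tsum_ofReal_lt_top
  refine ⟨ν + 1 + (∑' n, P (B n)).toReal, fun τ hτ => ?_⟩
  have hlog : 0 < Real.log τ := Real.log_pos hτ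
  have hcδ : 0 < c - δ := by linarith
  set N := ⌈Real.log τ / (c - δ)⌉₊ with hN
  have hN0 : 0 < N := Nat.ceil_pos.2 (div_pos hlog hcδ)
  have hNle : (N : ℝ) ≤ Real.log τ / (c - δ) + 1 := (Nat.ceil_lt_add_one (by positivity)).le
  have hpt (ω : Ω) : detectionTime P₀ lam S τ ω
      ≤ (ν + N : ℕ) + ∑' n, (B n).indicator (1 : Ω → ℝ≥0∞) ω := by
    refine le_add_tsum_indicator (B := {n | ω ∈ B n}) fun n hn hnB => ?_
    refine detectionTime_le (by linarith) (by lia) ?_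
    simp only [B, Set.mem_union, Set.mem_ofPred_eq, not_or, not_lt] at hnB
    rw [sum_Icc_one_add]
    have hNn : Real.log τ / (c - δ) ≤ n := (Nat.le_ceil _).trans (by exact_mod_cast hn)
    rw [div_le_iff₀ hcδ] at hNn
    linarith [hnB.1, hnB.2]
  calc ∫⁻ ω, detectionTime P₀ lam S τ ω ∂P
      ≤ ∫⁻ ω, (ν + N : ℕ) + ∑' n, (B n).indicator (1 : Ω → ℝ≥0∞) ω ∂P := lintegral_mono hpt
    _ = (ν + N : ℕ) + ∑' n, P (B n) := by
        rw [lintegral_add_left measurable_const,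
          lintegral_tsum fun n => (measurable_one.indicator (hBm n)).aemeasurable]
        simp only [lintegral_indicator_one (hBm _), lintegral_const, measure_univ, mul_one]
    _ = ENNReal.ofReal ((ν + N : ℕ) + (∑' n, P (B n)).toReal) := by
        rw [ENNReal.ofReal_add (by positivity) (by positivity), ENNReal.ofReal_natCast,
          ENNReal.ofReal_toReal hBsum.ne]
    _ ≤ _ := by
        refine ENNReal.ofReal_le_ofReal ?_
        push_cast
        linarith

/-- The limit of the averaged mean increments is the common mean after the change. -/
lemma eq_of_tendsto_average {Γ e : ℝ} {ν : ℕ} {u : ℕ → ℝ} (hu : ∀ j, u (ν + 1 + j) = e)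
    (h : Tendsto (fun t : ℕ => (1 / (t : ℝ)) * ∑ i ∈ Finset.Icc 1 t, u i) atTop (𝓝 Γ)) :
    e = Γ := by
  have h1 : Tendsto (fun i => u (i + 1)) atTop (𝓝 e) := by
    refine tendsto_const_nhds.congr' ?_
    filter_upwards [eventually_ge_atTop ν] with i hi
    obtain ⟨d, rfl⟩ := Nat.exists_eq_add_of_le hi
    rw [← hu d]
    congr 1
    ring
  refine tendsto_nhds_unique h1.cesaro (h.congr fun t => ?_)
  rw [sum_Icc_one_eq_sum_range, one_div]

end ShiftDetection

theorem mainTheorem4 {Ω : Type*} [MeasurableSpace Ω] (P : Measure Ω) [IsProbabilityMeasure P]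
    -- the null score law, with finite mean and finite moment generating function at `lam`
    (P₀ : Measure ℝ) [IsProbabilityMeasure P₀] (lam : ℝ)
    (hP₀_mean : Integrable (fun s : ℝ => s) P₀)
    (hP₀_mgf : Integrable (fun s : ℝ => Real.exp (lam * s)) P₀)
    -- the scores `S 1, S 2, …` (`S 0` plays no role) and the change point `ν`
    (S : ℕ → Ω → ℝ) (hS : ∀ t, Measurable (S t)) (ν : ℕ)
    -- the post-change scores `S (ν + 1), S (ν + 2), …` are stationary and `α`-mixing
    (h_stat : ShiftDetection.IsStationary P (fun j => S (ν + 1 + j)))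
    (h_mix : ShiftDetection.IsAlphaMixing P (fun j => S (ν + 1 + j)))
    (r : ℝ) (hr : 1 < r)
    (h_sum : Summable (fun n : ℕ =>
      (ShiftDetection.mixingCoeff P (fun j => S (ν + 1 + j)) (n + 1)) ^ (1 / r)))
    -- uniform exponential moment of the increments
    (η : ℝ) (hη : 0 < η)
    (h_exp : (⨆ (t : ℕ) (_ : 1 ≤ t), ∫⁻ ω, ENNReal.ofReal
      (Real.exp (η * |ShiftDetection.increment P₀ lam S t ω|)) ∂P) < ∞)
    -- the asymptotic mean increment exists and is positive
    (Γ : ℝ) (hΓ_pos : 0 < Γ)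
    (hΓ : Tendsto (fun t : ℕ => (1 / (t : ℝ)) *
      ∫ ω, (∑ i ∈ Finset.Icc 1 t, ShiftDetection.increment P₀ lam S i ω) ∂P) atTop (𝓝 Γ)) :
    ∀ ε : ℝ, 0 < ε → ∀ᶠ τ : ℝ in atTop,
      ∫⁻ ω, ShiftDetection.detectionTime P₀ lam S τ ω ∂P
        ≤ ENNReal.ofReal ((1 + ε) * (Real.log τ / Γ)) := by
  open ShiftDetection in
  intro ε hε
  let h : ℝ → ℝ := fun x => lam * (x - nullMean P₀) - logMgf P₀ lam
  have hh : Measurable h := by fun_prop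
  have hYm (t : ℕ) : Measurable (increment P₀ lam S t) := hh.comp (hS t)
  have hexp : ∀ t, 1 ≤ t → Integrable (fun ω => Real.exp (η * |increment P₀ lam S t ω|)) P := by
    intro t ht
    have hm : Measurable fun ω => Real.exp (η * |increment P₀ lam S t ω|) :=
      (((hYm t).abs).const_mul η).exp
    refine (lintegral_ofReal_ne_top_iff_integrable hm.aestronglyMeasurable
      (ae_of_all _ fun ω => (Real.exp_pos _).le)).1 (ne_of_lt (lt_of_le_of_lt ?_ h_exp))
    exact le_iSup₂ (f := fun (t : ℕ) (_ : 1 ≤ t) => ∫⁻ ω, ENNReal.ofReal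
      (Real.exp (η * |increment P₀ lam S t ω|)) ∂P) t ht
  have hint : ∀ t, 1 ≤ t → Integrable (increment P₀ lam S t) P := by
    intro t ht
    refine ((hexp t ht).const_mul η⁻¹).mono' (hYm t).aestronglyMeasurable (ae_of_all _ fun ω => ?_)
    rw [Real.norm_eq_abs, inv_mul_eq_div, le_div_iff₀ hη]
    linarith [Real.add_one_le_exp (η * |increment P₀ lam S t ω|)]
  -- the mean increment after the change is `Γ`
  have hmean (j : ℕ) : ∫ ω, increment P₀ lam S (ν + 1 + j) ω ∂P
      = ∫ ω, increment P₀ lam S (ν + 1) ω ∂P :=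
    ((h_stat.identDistrib j).comp hh).integral_eq
  have hΓ' : ∫ ω, increment P₀ lam S (ν + 1) ω ∂P = Γ := by
    refine eq_of_tendsto_average (u := fun i => ∫ ω, increment P₀ lam S i ω ∂P) hmean
      (hΓ.congr fun t => ?_)
    rw [integral_finsetSum _ fun i hi => hint i (Finset.mem_Icc.1 hi).1]
  -- slopes `s < c < Γ` with `1 / s = (1 + ε / 2) / Γ`
  set s := Γ / (1 + ε / 2) with hs
  have hs0 : 0 < s := by positivity
  have hsΓ : s < Γ := div_lt_self hΓ_pos (by linarith)
  have hsum := summable_measureReal_sum_lt (P := P) (X := fun j => S (ν + 1 + j))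
    (fun j => hS _) h_stat hr h_sum hh hη (hexp (ν + 1) (by lia)) (hint (ν + 1) (by lia))
    (c := (s + Γ) / 2) (by linarith)
    (show (s + Γ) / 2 < ∫ ω, increment P₀ lam S (ν + 1) ω ∂P by rw [hΓ']; linarith)
  obtain ⟨D, hD⟩ := exists_lintegral_detectionTime_le (ν := ν) (δ := (Γ - s) / 2) hYm hint
    (by linarith) (by linarith) hsum
  filter_upwards [eventually_gt_atTop 1,
    Real.tendsto_log_atTop.eventually_ge_atTop (D * (2 * Γ / ε))] with τ hτ1 hτ
  refine (hD τ hτ1).trans (ENNReal.ofReal_le_ofReal ?_)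
  have hDle : D ≤ ε / 2 * (Real.log τ / Γ) := by
    calc D = D * (2 * Γ / ε) * (ε / (2 * Γ)) := by field_simp
      _ ≤ Real.log τ * (ε / (2 * Γ)) := by gcongr
      _ = _ := by field_simp
  have hmain : Real.log τ / ((s + Γ) / 2 - (Γ - s) / 2) = (1 + ε / 2) * (Real.log τ / Γ) := by
    rw [show (s + Γ) / 2 - (Γ - s) / 2 = s by ring, hs]
    field_simp
  linarith
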